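/- By a convex body we mean a compact convex set with non-empty interior in $\mathbb{R}^d$. For a convex body $C$ with $0$ in its interior let $\|x\|_C=\inf\{r>0: x\in rC\}$ be its gauge. A convex body $K$ is $\lambda$-strongly convex with respect to $C$ if $\frac{x+y}{2}+\lambda\|x-y\|_C^2\, C\subseteq K$ for all $x,y\in K$. A function $f$ is $L$-strongly smooth over $K$ if $f(ax+(1-a)y)\ge a f(x)+(1-a)f(y)-L\,a(1-a)\|x-y\|_2^2$ for all $x,y\in K$ and $a\in[0,1]$. **The Frank–Wolfe-type algorithm of Wang and Abernethy** for $\min_{x\in K} f(x)$, where $0\in\operatorname{int}K$, with step size $\eta>0$, starting point $x_0\in K$, weights $\alpha_t=t$ and $A_t=\sum_{s=1}^t\alpha_s$: in iteration $t=1,2,\dots$ put $$\tilde x_t=\frac1{A_t}\Big(\sum_{s=1}^{t-1}\alpha_s x_s+\alpha_t x_{t-1}\Big),\qquad y_t=\nabla f(\tilde x_t),$$ choose $$(v_t,\rho_t)\in\operatorname*{argmin}_{v\in K,\ \rho\in[0,1]}\ \rho\Big\langle \sum_{s=1}^t\alpha_s y_s,\,v\Big\rangle+\frac{\rho^2}{\eta},$$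 and set $x_t=\rho_t v_t$. The output after $T$ iterations is $\bar x_T=\frac1{A_T}\sum_{t=1}^T\alpha_t x_t$. **Corollary.** Let $K\subseteq\mathbb{R}^d$ be a convex body with $0\in\operatorname{int}K$ that is $\lambda$-strongly convex with respect to $C$, for some $\lambda>0$ and some convex body $C$ with $0\in\operatorname{int}C$. 1. For every $L\ge 0$ there is $\eta_0>0$ such that for every $\eta\in(0,\eta_0]$ there is a constant $M$ (so $\eta_0$ depends only on $K$ and $L$, and $M$ only on $K$, $L$ and $\eta$) with the following property. For every convex $f:\mathbb{R}^d\to\mathbb{R}$ that is differentiable at every point of $K$ and $L$-strongly smooth over $K$, and for every $x_0\in K$, the algorithm with step size $\eta$ started at $x_0$ is well defined (the minimizers exist in all iterations), and, whatever minimizers are chosen, for all $T\ge1$, $$\bar x_T\in K\qquad\text{and}\qquad f(\bar x_T)-\min_{x\in K}f(x)\le\frac{M}{T^2}.$$ 2. The modulus of smoothness is always finite: every twice continuously differentiable convex $f:\mathbb{R}^d\to\mathbb{R}$ is $L$-strongly smooth over $K$ for some finite $L\ge 0$. So part 1 requires no curvature (strong convexity) of the objective. -/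

import Mathlib

open scoped RealInnerProductSpace

/-- A convex body: a compact convex set with non-empty interior. -/
structure IsConvexBody {d : ℕ} (K : Set (EuclideanSpace ℝ (Fin d))) : Prop where
  convex : Convex ℝ K
  isCompact : IsCompact K
  interior_nonempty : (interior K).Nonempty

/-- `K` is `lam`-strongly convex with respect to `C`: for all `x, y ∈ K` the set
`(x + y) / 2 + lam * ‖x - y‖_C ^ 2 • C` is contained in `K`, where `‖·‖_C` is the gauge of `C`. -/
def IsStronglyConvexSet {d : ℕ} (lam : ℝ) (C K : Set (EuclideanSpace ℝ (Fin d))) : Prop :=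
  ∀ x ∈ K, ∀ y ∈ K, ∀ c ∈ C,
    (1 / 2 : ℝ) • (x + y) + (lam * gauge C (x - y) ^ 2) • c ∈ K

/-- `f` is `G`-strongly smooth over `K` with respect to the Euclidean norm. -/
def IsStronglySmoothOn {d : ℕ} (G : ℝ) (K : Set (EuclideanSpace ℝ (Fin d)))
    (f : EuclideanSpace ℝ (Fin d) → ℝ) : Prop :=
  ∀ x ∈ K, ∀ y ∈ K, ∀ a ∈ Set.Icc (0 : ℝ) 1,
    a * f x + (1 - a) * f y - G * (a * (1 - a)) * ‖x - y‖ ^ 2 ≤ f (a • x + (1 - a) • y)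

/-- The sum `A_t = 1 + 2 + ⋯ + t` of the weights `α_s = s`. -/
noncomputable def weightSum (t : ℕ) : ℝ := ∑ s ∈ Finset.Icc 1 t, (s : ℝ)

/-- The output after `T` iterations: the weighted average `(∑_{t ≤ T} α_t x_t) / A_T` of the
iterates `x_1, …, x_T`. -/
noncomputable def averagedIterate {d : ℕ} (x : ℕ → EuclideanSpace ℝ (Fin d)) (T : ℕ) :
    EuclideanSpace ℝ (Fin d) :=
  (weightSum T)⁻¹ • ∑ t ∈ Finset.Icc 1 T, (t : ℝ) • x t

/-- The point `(∑_{s < t} α_s x_s + α_t x_{t-1}) / A_t` at which iteration `t ≥ 1` evaluates the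
gradient of the objective (the play of Optimistic Follow-the-Leader is the gradient there). -/
noncomputable def queryPoint {d : ℕ} (x : ℕ → EuclideanSpace ℝ (Fin d)) (t : ℕ) :
    EuclideanSpace ℝ (Fin d) :=
  (weightSum t)⁻¹ • (∑ s ∈ Finset.Ico 1 t, (s : ℝ) • x s + (t : ℝ) • x (t - 1))

/-- The aggregated gradient `∑_{s ≤ t} α_s ∇f(query point of iteration s)`. It involves the
iterates `x_0, …, x_{t-1}` only. -/
noncomputable def aggregatedGradient {d : ℕ} (f : EuclideanSpace ℝ (Fin d) → ℝ)
    (x : ℕ → EuclideanSpace ℝ (Fin d)) (t : ℕ) : EuclideanSpace ℝ (Fin d) :=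
  ∑ s ∈ Finset.Icc 1 t, (s : ℝ) • gradient f (queryPoint x s)

/-- `(x, v, ρ)` is a run, with step size `η` and starting point `x₀`, of the Frank-Wolfe-type
algorithm of Wang and Abernethy for minimizing `f` over `K`. In iteration `t ≥ 1`, with aggregated
gradient `s_t`, the algorithm chooses
`(v_t, ρ_t) ∈ argmin {r * ⟪s_t, z⟫ + r ^ 2 / η : z ∈ K, r ∈ [0, 1]}` and plays `x_t = ρ_t v_t`.
This is one linear optimization over `K` followed by a one-dimensional one; as the least `r ≥ 0`
with `w ∈ r • K` is the gauge `‖w‖_K`, it is Be-the-Regularized-Leader over `K` with the squared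
gauge as regularizer. -/
structure IsGaugeFrankWolfeRun {d : ℕ} (K : Set (EuclideanSpace ℝ (Fin d)))
    (f : EuclideanSpace ℝ (Fin d) → ℝ) (η : ℝ) (x₀ : EuclideanSpace ℝ (Fin d))
    (x v : ℕ → EuclideanSpace ℝ (Fin d)) (ρ : ℕ → ℝ) : Prop where
  init : x 0 = x₀
  direction_mem : ∀ t, 1 ≤ t → v t ∈ K
  scale_mem : ∀ t, 1 ≤ t → ρ t ∈ Set.Icc (0 : ℝ) 1
  isMin : ∀ t, 1 ≤ t → ∀ z ∈ K, ∀ r ∈ Set.Icc (0 : ℝ) 1,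
    ρ t * ⟪aggregatedGradient f x t, v t⟫ + ρ t ^ 2 / η
      ≤ r * ⟪aggregatedGradient f x t, z⟫ + r ^ 2 / η
  step : ∀ t, 1 ≤ t → x t = ρ t • v t

section Gauge

variable {E : Type*} [NormedAddCommGroup E] [NormedSpace ℝ E]

/-- A point of a compact convex neighbourhood of zero attains its gauge. -/
theorem exists_mem_eq_gauge_smul {K : Set E} (hK : Convex ℝ K) (hc : IsCompact K)
    (h0 : K ∈ nhds (0 : E)) (x : E) : ∃ p ∈ K, x = gauge K x • p := by
  rcases (gauge_nonneg (s := K) x).eq_or_lt with h | h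
  · refine ⟨0, mem_of_mem_nhds h0, ?_⟩
    have hb : Bornology.IsVonNBounded ℝ K := (NormedSpace.isVonNBounded_iff ℝ).2 hc.isBounded
    rw [(gauge_eq_zero (absorbent_nhds_zero h0) hb).1 h.symm, smul_zero]
  · refine ⟨(gauge K x)⁻¹ • x, ?_, ?_⟩
    · refine hc.isClosed.closure_subset ((gauge_le_one_iff_mem_closure hK h0).1 ?_)
      rw [gauge_smul_of_nonneg (inv_nonneg.2 h.le), smul_eq_mul, inv_mul_cancel₀ h.ne']
    · rw [smul_smul, mul_inv_cancel₀ h.ne', one_smul]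

/-- If midpoints of `K` are centres of balls in `K` whose radius is quadratic in the distance, then
the gauge of a midpoint is quadratically smaller than one. -/
theorem exists_gauge_midpoint_le {K : Set E} {δ R : ℝ} (hδ : 0 < δ) (hR : 0 < R)
    (hKR : ∀ x ∈ K, ‖x‖ ≤ R)
    (hball : ∀ x ∈ K, ∀ y ∈ K, ∀ e : E, ‖e‖ ≤ δ * ‖x - y‖ ^ 2 → (1 / 2 : ℝ) • (x + y) + e ∈ K) :
    ∃ κ : ℝ, 0 < κ ∧ ∀ p ∈ K, ∀ q ∈ K,
      gauge K ((1 / 2 : ℝ) • (p + q)) ≤ 1 - κ * ‖p - q‖ ^ 2 := by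
  refine ⟨(δ / R) / (1 + 4 * δ * R), by positivity, fun p hp q hq => ?_⟩
  set m := (1 / 2 : ℝ) • (p + q) with hm
  set s := ‖p - q‖ ^ 2 with hs
  have hs0 : 0 ≤ s := by positivity
  have hs4 : s ≤ 4 * R ^ 2 := by
    have h1 : ‖p - q‖ ≤ 2 * R := (norm_sub_le p q).trans (by linarith [hKR p hp, hKR q hq])
    nlinarith [norm_nonneg (p - q)]
  have hmK : m ∈ K := by
    have := hball p hp q hq 0 (by rw [norm_zero]; positivity)
    rwa [add_zero] at this
  set w := δ * s / R with hw
  have hw0 : 0 ≤ w := by positivity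
  have hw4 : w ≤ 4 * δ * R := by
    rw [hw, div_le_iff₀ hR]
    nlinarith
  have hmem : (1 + w) • m ∈ K := by
    rw [add_smul, one_smul]
    refine hball p hp q hq _ ?_
    rw [norm_smul, Real.norm_of_nonneg hw0]
    calc w * ‖m‖ ≤ w * R := by gcongr; exact hKR m hmK
      _ = δ * s := by rw [hw]; field_simp
  have hle := gauge_le_one_of_mem hmem
  rw [gauge_smul_of_nonneg (by positivity), smul_eq_mul] at hle
  have h1 : gauge K m ≤ 1 / (1 + w) := by
    rw [le_div_iff₀ (by positivity)]; linarith
  have h2 : (δ / R) / (1 + 4 * δ * R) * s ≤ w / (1 + w) := by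
    have : (δ / R) / (1 + 4 * δ * R) * s = w / (1 + 4 * δ * R) := by rw [hw]; ring
    rw [this]
    gcongr
  have h3 : 1 / (1 + w) = 1 - w / (1 + w) := by field_simp; ring
  linarith

/-- The squared gauge of a uniformly convex body (of power type two) is strongly convex at
midpoints. -/
theorem exists_gauge_sq_midpoint_le {K : Set E} (hK : Convex ℝ K) (hc : IsCompact K)
    (h0 : K ∈ nhds (0 : E)) {δ : ℝ} (hδ : 0 < δ)
    (hball : ∀ x ∈ K, ∀ y ∈ K, ∀ e : E, ‖e‖ ≤ δ * ‖x - y‖ ^ 2 → (1 / 2 : ℝ) • (x + y) + e ∈ K) :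
    ∃ c : ℝ, 0 < c ∧ ∀ x y : E, gauge K ((1 / 2 : ℝ) • (x + y)) ^ 2 ≤
      (gauge K x ^ 2 + gauge K y ^ 2) / 2 - c * ‖x - y‖ ^ 2 := by
  obtain ⟨R, hR, hKR⟩ := hc.isBounded.exists_pos_norm_le
  obtain ⟨κ, hκ, hmid⟩ := exists_gauge_midpoint_le hδ hR hKR hball
  refine ⟨min (κ / 2) (1 / (8 * R ^ 2)), by positivity, ?_⟩
  set c := min (κ / 2) (1 / (8 * R ^ 2)) with hcdef
  have hc0 : 0 ≤ c := by positivity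
  have hc1 : 2 * c ≤ κ := by have := min_le_left (κ / 2) (1 / (8 * R ^ 2)); linarith
  have hc2 : 2 * c * R ^ 2 ≤ 1 / 4 := by
    have := min_le_right (κ / 2) (1 / (8 * R ^ 2))
    rw [← hcdef, le_div_iff₀ (by positivity)] at this
    linarith
  have key : ∀ x y : E, gauge K x ≤ gauge K y → gauge K ((1 / 2 : ℝ) • (x + y)) ^ 2 ≤
      (gauge K x ^ 2 + gauge K y ^ 2) / 2 - c * ‖x - y‖ ^ 2 := by
    intro x y hxy
    obtain ⟨p, hp, hxp⟩ := exists_mem_eq_gauge_smul hK hc h0 x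
    obtain ⟨q, hq, hyq⟩ := exists_mem_eq_gauge_smul hK hc h0 y
    have ha : 0 ≤ gauge K x := gauge_nonneg x
    set a := gauge K x
    set b := gauge K y
    set s := ‖p - q‖ ^ 2 with hs
    have hs0 : 0 ≤ s := by positivity
    set g := gauge K ((1 / 2 : ℝ) • (x + y))
    have hg0 : 0 ≤ g := gauge_nonneg _
    have hg : g ≤ (a + b) / 2 - a * (κ * s) := by
      have e : (1 / 2 : ℝ) • (x + y) = a • ((1 / 2 : ℝ) • (p + q)) + ((b - a) / 2) • q := by
        rw [hxp, hyq]; module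
      have h1 : g ≤ a * gauge K ((1 / 2 : ℝ) • (p + q)) + (b - a) / 2 * gauge K q := by
        calc g = gauge K (a • ((1 / 2 : ℝ) • (p + q)) + ((b - a) / 2) • q) := by rw [← e]
          _ ≤ _ := gauge_add_le hK (absorbent_nhds_zero h0) _ _
          _ = _ := by
            rw [gauge_smul_of_nonneg ha,
              gauge_smul_of_nonneg (by linarith : 0 ≤ (b - a) / 2) q, smul_eq_mul, smul_eq_mul]
      have h2 := mul_le_mul_of_nonneg_left (hmid p hp q hq) ha
      have h3 := mul_le_mul_of_nonneg_left (gauge_le_one_of_mem hq)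
        (by linarith : 0 ≤ (b - a) / 2)
      linarith
    have hn : ‖x - y‖ ^ 2 ≤ 2 * a ^ 2 * s + 2 * (b - a) ^ 2 * R ^ 2 := by
      have e : x - y = a • (p - q) - (b - a) • q := by
        rw [hxp, hyq]; module
      have h1 : ‖x - y‖ ≤ a * ‖p - q‖ + (b - a) * R := by
        calc ‖x - y‖ = ‖a • (p - q) - (b - a) • q‖ := by rw [← e]
          _ ≤ ‖a • (p - q)‖ + ‖(b - a) • q‖ := norm_sub_le _ _
          _ = a * ‖p - q‖ + (b - a) * ‖q‖ := by
            rw [norm_smul, norm_smul, Real.norm_of_nonneg ha, Real.norm_of_nonneg (by linarith)]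
          _ ≤ _ := by
            have := mul_le_mul_of_nonneg_left (hKR q hq) (by linarith : 0 ≤ b - a)
            linarith
      calc ‖x - y‖ ^ 2 ≤ (a * ‖p - q‖ + (b - a) * R) ^ 2 := by gcongr
        _ ≤ 2 * (a * ‖p - q‖) ^ 2 + 2 * ((b - a) * R) ^ 2 := by
          linarith [sq_nonneg (a * ‖p - q‖ - (b - a) * R)]
        _ = _ := by rw [hs]; ring
    have hg2 : g ^ 2 ≤ ((a + b) / 2) ^ 2 - a ^ 2 * (κ * s) := by
      have ht : 0 ≤ a * (κ * s) := by positivity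
      have h1 : g * g ≤ ((a + b) / 2) * ((a + b) / 2 - a * (κ * s)) :=
        mul_le_mul (by linarith) hg hg0 (by linarith)
      have h2 : a * (a * (κ * s)) ≤ (a + b) / 2 * (a * (κ * s)) :=
        mul_le_mul_of_nonneg_right (by linarith) ht
      linarith
    have h1 := mul_le_mul_of_nonneg_left hn hc0
    have h2 : 2 * c * (a ^ 2 * s) ≤ κ * (a ^ 2 * s) := by gcongr
    have h3 := mul_le_mul_of_nonneg_right hc2 (sq_nonneg (b - a))
    linarith
  intro x y
  rcases le_total (gauge K x) (gauge K y) with h | h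
  · exact key x y h
  · have := key y x h
    rw [norm_sub_rev y x, add_comm y x] at this
    linarith

end Gauge

/-- A body that is strongly convex with respect to a bounded neighbourhood of zero contains
Euclidean balls around midpoints whose radius is quadratic in the distance. -/
theorem IsStronglyConvexSet.exists_ball {d : ℕ} {lam : ℝ}
    {C K : Set (EuclideanSpace ℝ (Fin d))} (hKC : IsStronglyConvexSet lam C K) (hlam : 0 < lam)
    (hC : Bornology.IsBounded C) (hC0 : C ∈ nhds (0 : EuclideanSpace ℝ (Fin d))) :
    ∃ δ : ℝ, 0 < δ ∧ ∀ x ∈ K, ∀ y ∈ K, ∀ e : EuclideanSpace ℝ (Fin d),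
      ‖e‖ ≤ δ * ‖x - y‖ ^ 2 → (1 / 2 : ℝ) • (x + y) + e ∈ K := by
  obtain ⟨Q, hQ, hCQ⟩ := hC.exists_pos_norm_le
  obtain ⟨r, hr, hrC⟩ := Metric.nhds_basis_closedBall.mem_iff.1 hC0
  refine ⟨lam * r / Q ^ 2, by positivity, fun x hx y hy e he => ?_⟩
  have hg : ‖x - y‖ / Q ≤ gauge C (x - y) :=
    le_gauge_of_subset_closedBall (absorbent_nhds_zero hC0) hQ.le
      fun z hz => by simpa using hCQ z hz
  rcases eq_or_ne x y with rfl | hxy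
  · have : e = 0 := by simpa using he
    subst this
    have := hKC x hx x hx 0 (mem_of_mem_nhds hC0)
    simpa using this
  · have hn : 0 < ‖x - y‖ := norm_pos_iff.2 (sub_ne_zero.2 hxy)
    have hgp : 0 < gauge C (x - y) := lt_of_lt_of_le (by positivity) hg
    set t := lam * gauge C (x - y) ^ 2 with ht
    have htp : 0 < t := by positivity
    have hle : ‖e‖ ≤ t * r := by
      calc ‖e‖ ≤ lam * r / Q ^ 2 * ‖x - y‖ ^ 2 := he
        _ = lam * (‖x - y‖ / Q) ^ 2 * r := by ring
        _ ≤ lam * gauge C (x - y) ^ 2 * r := by gcongr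
    have hmem : t⁻¹ • e ∈ C := by
      apply hrC
      rw [mem_closedBall_zero_iff, norm_smul, Real.norm_of_nonneg (by positivity),
        inv_mul_le_iff₀ htp]
      exact hle
    have := hKC x hx y hy _ hmem
    rwa [← ht, smul_smul, mul_inv_cancel₀ htp.ne', one_smul] at this

section FirstOrder

variable {E : Type*} [NormedAddCommGroup E] [InnerProductSpace ℝ E] [CompleteSpace E]

theorem tendsto_slope_inner_gradient {f : E → ℝ} {x : E} (hf : DifferentiableAt ℝ f x) (v : E) :
    Filter.Tendsto (fun t : ℝ => t⁻¹ * (f (x + t • v) - f x)) (nhdsWithin 0 (Set.Ioi 0))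
      (nhds ⟪gradient f x, v⟫) := by
  rw [inner_gradient_left]
  exact (hf.hasFDerivAt.hasLineDerivAt v).tendsto_slope_zero_right

theorem ConvexOn.add_inner_gradient_le {f : E → ℝ} (hf : ConvexOn ℝ Set.univ f) {x : E}
    (hx : DifferentiableAt ℝ f x) (z : E) : f x + ⟪gradient f x, z - x⟫ ≤ f z := by
  have h := le_of_tendsto (b := f z - f x) (tendsto_slope_inner_gradient hx (z - x)) (by
    filter_upwards [Ioo_mem_nhdsGT (zero_lt_one (α := ℝ))] with t ht
    rw [inv_mul_le_iff₀ ht.1]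
    have h1 := hf.2 (Set.mem_univ x) (Set.mem_univ z) (by linarith [ht.2] : 0 ≤ 1 - t) ht.1.le
      (by ring)
    have e : (1 - t) • x + t • z = x + t • (z - x) := by module
    rw [e, smul_eq_mul, smul_eq_mul] at h1
    linarith)
  linarith

end FirstOrder

theorem IsStronglySmoothOn.le_add_inner_gradient {d : ℕ} {L : ℝ}
    {K : Set (EuclideanSpace ℝ (Fin d))} {f : EuclideanSpace ℝ (Fin d) → ℝ}
    (hf : IsStronglySmoothOn L K f) {x z : EuclideanSpace ℝ (Fin d)} (hxK : x ∈ K)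
    (hx : DifferentiableAt ℝ f x) (hz : z ∈ K) :
    f z ≤ f x + ⟪gradient f x, z - x⟫ + L * ‖z - x‖ ^ 2 := by
  have hlim : Filter.Tendsto (fun t : ℝ => f z - f x - L * (1 - t) * ‖z - x‖ ^ 2)
      (nhdsWithin 0 (Set.Ioi 0)) (nhds (f z - f x - L * (1 - 0) * ‖z - x‖ ^ 2)) :=
    (Continuous.tendsto (by fun_prop) 0).mono_left nhdsWithin_le_nhds
  have h := le_of_tendsto_of_tendsto hlim (tendsto_slope_inner_gradient hx (z - x)) (by
    filter_upwards [Ioo_mem_nhdsGT (zero_lt_one (α := ℝ))] with t ht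
    rw [le_inv_mul_iff₀ ht.1]
    have h1 := hf z hz x hxK t ⟨ht.1.le, ht.2.le⟩
    have e : t • z + (1 - t) • x = x + t • (z - x) := by module
    rw [e] at h1
    linarith)
  linarith

/-- A twice continuously differentiable function is strongly smooth over every compact convex
set. -/
theorem ContDiff.exists_isStronglySmoothOn {d : ℕ} {K : Set (EuclideanSpace ℝ (Fin d))}
    (hK : Convex ℝ K) (hc : IsCompact K) {f : EuclideanSpace ℝ (Fin d) → ℝ}
    (hf : ContDiff ℝ 2 f) : ∃ L : ℝ, 0 ≤ L ∧ IsStronglySmoothOn L K f := by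
  have hf1 : ContDiff ℝ 1 (fderiv ℝ f) := hf.fderiv_right (by norm_num)
  have hcont : Continuous (fun x => ‖fderiv ℝ (fderiv ℝ f) x‖₊) :=
    (hf1.continuous_fderiv (by norm_num)).nnnorm
  obtain ⟨M, hM⟩ := (hc.image hcont).bddAbove
  have hlip : LipschitzOnWith M (fderiv ℝ f) K :=
    hK.lipschitzOnWith_of_nnnorm_fderiv_le
      (fun x _ => (hf1.differentiable (by norm_num)).differentiableAt)
      (fun x hx => hM (Set.mem_image_of_mem _ hx))
  have htaylor : ∀ z ∈ K, ∀ x ∈ K, f x ≤ f z + fderiv ℝ f z (x - z) + M * ‖x - z‖ ^ 2 := by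
    intro z hz x hx
    have hseg : segment ℝ z x ⊆ K := hK.segment_subset hz hx
    have h := Convex.norm_image_sub_le_of_norm_fderiv_le' (𝕜 := ℝ) (f := f) (s := segment ℝ z x)
      (φ := fderiv ℝ f z) (C := M * ‖x - z‖) (x := z) (y := x)
      (fun w _ => (hf.differentiable (by norm_num)).differentiableAt)
      (fun w hw => by
        refine (hlip.norm_sub_le (hseg hw) hz).trans ?_
        gcongr
        obtain ⟨a, ha, rfl⟩ := (segment_eq_image' ℝ z x).le hw
        rw [add_sub_cancel_left, norm_smul, Real.norm_of_nonneg ha.1]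
        exact mul_le_of_le_one_left (norm_nonneg _) ha.2)
      (convex_segment z x) (left_mem_segment ℝ z x) (right_mem_segment ℝ z x)
    have := (Real.le_norm_self _).trans h
    nlinarith
  refine ⟨M, M.2, fun x hx y hy a ha => ?_⟩
  have hz : a • x + (1 - a) • y ∈ K := hK hx hy ha.1 (by linarith [ha.2]) (by ring)
  have h1 := mul_le_mul_of_nonneg_left (htaylor _ hz x hx) ha.1
  have h2 := mul_le_mul_of_nonneg_left (htaylor _ hz y hy) (by linarith [ha.2] : 0 ≤ 1 - a)
  have e1 : x - (a • x + (1 - a) • y) = (1 - a) • (x - y) := by module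
  have e2 : y - (a • x + (1 - a) • y) = (-a) • (x - y) := by module
  rw [e1, map_smul, norm_smul, smul_eq_mul, Real.norm_of_nonneg (by linarith [ha.2])] at h1
  rw [e2, map_smul, norm_smul, smul_eq_mul, norm_neg, Real.norm_of_nonneg ha.1] at h2
  linarith

theorem weightSum_succ (n : ℕ) : weightSum (n + 1) = weightSum n + ((n + 1 : ℕ) : ℝ) := by
  rw [weightSum, Finset.sum_Icc_succ_top (by omega), weightSum]

theorem weightSum_eq (n : ℕ) : weightSum n = n * (n + 1) / 2 := by
  induction n with
  | zero => simp [weightSum]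
  | succ n ih => rw [weightSum_succ, ih]; push_cast; ring

theorem weightSum_pos (n : ℕ) : 0 < weightSum (n + 1) := by
  rw [weightSum_eq]; positivity

section Iterates

variable {d : ℕ} (x : ℕ → EuclideanSpace ℝ (Fin d))

theorem weightSum_smul_averagedIterate (n : ℕ) :
    weightSum n • averagedIterate x n = ∑ t ∈ Finset.Icc 1 n, (t : ℝ) • x t := by
  cases n with
  | zero => simp [weightSum]
  | succ n => rw [averagedIterate, smul_smul, mul_inv_cancel₀ (weightSum_pos n).ne', one_smul]

theorem weightSum_smul_averagedIterate_succ (n : ℕ) :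
    weightSum (n + 1) • averagedIterate x (n + 1) =
      weightSum n • averagedIterate x n + ((n + 1 : ℕ) : ℝ) • x (n + 1) := by
  rw [weightSum_smul_averagedIterate, weightSum_smul_averagedIterate,
    Finset.sum_Icc_succ_top (by omega)]

theorem weightSum_smul_queryPoint_succ (n : ℕ) :
    weightSum (n + 1) • queryPoint x (n + 1) =
      weightSum n • averagedIterate x n + ((n + 1 : ℕ) : ℝ) • x n := by
  rw [weightSum_smul_averagedIterate, queryPoint, smul_smul,
    mul_inv_cancel₀ (weightSum_pos n).ne', one_smul, Nat.add_sub_cancel]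
  rfl

/-- A weighted mean of two points of a convex set lies in it. -/
theorem mem_of_add_smul_eq {E : Type*} [AddCommGroup E] [Module ℝ E] {K : Set E}
    (hK : Convex ℝ K) {A α : ℝ} (hA : 0 ≤ A) (hα : 0 ≤ α) (h : 0 < A + α) {p q z : E}
    (hp : p ∈ K) (hq : q ∈ K) (hz : (A + α) • z = A • p + α • q) : z ∈ K := by
  have e : z = (A / (A + α)) • p + (α / (A + α)) • q := by
    rw [div_eq_inv_mul, div_eq_inv_mul, mul_smul, mul_smul, ← smul_add, ← hz, smul_smul,
      inv_mul_cancel₀ h.ne', one_smul]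
  rw [e]
  exact hK hp hq (by positivity) (by positivity) (by rw [← add_div, div_self h.ne'])

variable {x} {K : Set (EuclideanSpace ℝ (Fin d))}

theorem averagedIterate_mem (hK : Convex ℝ K) (h0 : (0 : EuclideanSpace ℝ (Fin d)) ∈ K)
    (hx : ∀ t, x t ∈ K) (n : ℕ) : averagedIterate x n ∈ K := by
  induction n with
  | zero => simpa [averagedIterate] using h0
  | succ n ih =>
    have hA : 0 ≤ weightSum n := by rw [weightSum_eq]; positivity
    have hs := weightSum_smul_averagedIterate_succ x n
    have hp := weightSum_pos n
    rw [weightSum_succ] at hs hp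
    exact mem_of_add_smul_eq hK hA (Nat.cast_nonneg _) hp ih (hx _) hs

theorem queryPoint_mem (hK : Convex ℝ K) (h0 : (0 : EuclideanSpace ℝ (Fin d)) ∈ K)
    (hx : ∀ t, x t ∈ K) (n : ℕ) : queryPoint x (n + 1) ∈ K := by
  have hA : 0 ≤ weightSum n := by rw [weightSum_eq]; positivity
  have hs := weightSum_smul_queryPoint_succ x n
  have hp := weightSum_pos n
  rw [weightSum_succ] at hs hp
  exact mem_of_add_smul_eq hK hA (Nat.cast_nonneg _) hp (averagedIterate_mem hK h0 hx n) (hx _) hs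

theorem aggregatedGradient_succ (f : EuclideanSpace ℝ (Fin d) → ℝ)
    (x : ℕ → EuclideanSpace ℝ (Fin d)) (n : ℕ) :
    aggregatedGradient f x (n + 1) =
      aggregatedGradient f x n + ((n + 1 : ℕ) : ℝ) • gradient f (queryPoint x (n + 1)) := by
  rw [aggregatedGradient, Finset.sum_Icc_succ_top (by omega), aggregatedGradient]

theorem aggregatedGradient_congr (f : EuclideanSpace ℝ (Fin d) → ℝ)
    {x y : ℕ → EuclideanSpace ℝ (Fin d)} {t : ℕ} (h : ∀ s < t, x s = y s) :
    aggregatedGradient f x t = aggregatedGradient f y t := by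
  refine Finset.sum_congr rfl fun s hs => ?_
  rw [Finset.mem_Icc] at hs
  have hq : queryPoint x s = queryPoint y s := by
    rw [queryPoint, queryPoint, h (s - 1) (by omega)]
    congr 2
    refine Finset.sum_congr rfl fun i hi => ?_
    rw [Finset.mem_Ico] at hi
    rw [h i (by omega)]
  rw [hq]

/-- One step of the primal-dual analysis: the growth of the weighted suboptimality is bounded by
the linear regret of the step and the squared movement of the iterates. -/
theorem weightSum_mul_le_succ {L : ℝ} (hL : 0 ≤ L) (hK : Convex ℝ K)
    (h0 : (0 : EuclideanSpace ℝ (Fin d)) ∈ K) (hx : ∀ t, x t ∈ K)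
    {f : EuclideanSpace ℝ (Fin d) → ℝ} (hf : ConvexOn ℝ Set.univ f)
    (hd : ∀ x ∈ K, DifferentiableAt ℝ f x) (hs : IsStronglySmoothOn L K f) (n : ℕ)
    (u : EuclideanSpace ℝ (Fin d)) :
    weightSum (n + 1) * (f (averagedIterate x (n + 1)) - f u) ≤
      weightSum n * (f (averagedIterate x n) - f u) +
        ⟪((n + 1 : ℕ) : ℝ) • gradient f (queryPoint x (n + 1)), x (n + 1) - u⟫ +
        2 * L * ‖x (n + 1) - x n‖ ^ 2 := by
  have hq := queryPoint_mem hK h0 hx n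
  have hb' := averagedIterate_mem hK h0 hx (n + 1)
  have e1 := weightSum_smul_averagedIterate_succ x n
  have e2 := weightSum_smul_queryPoint_succ x n
  have hA' := weightSum_pos n
  have hA : 0 ≤ weightSum n := by rw [weightSum_eq]; positivity
  have hsucc := weightSum_succ n
  have hα : 0 ≤ ((n + 1 : ℕ) : ℝ) := Nat.cast_nonneg _
  have hα2 : ((n + 1 : ℕ) : ℝ) ^ 2 ≤ 2 * weightSum (n + 1) := by
    rw [weightSum_eq]; nlinarith
  have i1 := mul_le_mul_of_nonneg_left (hs.le_add_inner_gradient hq (hd _ hq) hb') hA'.le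
  have i2 := mul_le_mul_of_nonneg_left (hf.add_inner_gradient_le (hd _ hq) (averagedIterate x n)) hA
  have i3 := mul_le_mul_of_nonneg_left (hf.add_inner_gradient_le (hd _ hq) u) hα
  set y := gradient f (queryPoint x (n + 1))
  set α := ((n + 1 : ℕ) : ℝ)
  set A' := weightSum (n + 1)
  set A := weightSum n
  set b' := averagedIterate x (n + 1)
  set b := averagedIterate x n
  set q := queryPoint x (n + 1)
  have j1 : A' * ⟪y, b'⟫ = A * ⟪y, b⟫ + α * ⟪y, x (n + 1)⟫ := by
    simpa only [inner_add_right, real_inner_smul_right] using congrArg (fun z => ⟪y, z⟫) e1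
  have hmove : A' * (L * ‖b' - q‖ ^ 2) ≤ 2 * L * ‖x (n + 1) - x n‖ ^ 2 := by
    have e3 : A' • (b' - q) = α • (x (n + 1) - x n) := by
      rw [smul_sub, e1, e2]; module
    have e4 : A' * ‖b' - q‖ = α * ‖x (n + 1) - x n‖ := by
      simpa only [norm_smul, Real.norm_of_nonneg hα, Real.norm_of_nonneg hA'.le] using
        congrArg norm e3
    refine le_of_mul_le_mul_left ?_ hA'
    calc A' * (A' * (L * ‖b' - q‖ ^ 2)) = L * (A' * ‖b' - q‖) ^ 2 := by ring
      _ = L * ‖x (n + 1) - x n‖ ^ 2 * α ^ 2 := by rw [e4]; ring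
      _ ≤ L * ‖x (n + 1) - x n‖ ^ 2 * (2 * A') := by gcongr
      _ = _ := by ring
  rw [real_inner_smul_left]
  simp only [inner_sub_right] at i1 i2 i3 ⊢
  rw [hsucc] at i1 j1 hmove ⊢
  linarith

end Iterates

section Run

variable {d : ℕ} {K : Set (EuclideanSpace ℝ (Fin d))} {f : EuclideanSpace ℝ (Fin d) → ℝ}
  {η : ℝ} {x₀ : EuclideanSpace ℝ (Fin d)}

theorem exists_isGaugeFrankWolfeRun (hc : IsCompact K) (hne : K.Nonempty)
    (f : EuclideanSpace ℝ (Fin d) → ℝ) (η : ℝ) (x₀ : EuclideanSpace ℝ (Fin d)) :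
    ∃ (x v : ℕ → EuclideanSpace ℝ (Fin d)) (ρ : ℕ → ℝ), IsGaugeFrankWolfeRun K f η x₀ x v ρ := by
  have hmin : ∀ S : EuclideanSpace ℝ (Fin d), ∃ w : EuclideanSpace ℝ (Fin d) × ℝ,
      w ∈ K ×ˢ Set.Icc (0 : ℝ) 1 ∧ ∀ z ∈ K, ∀ r ∈ Set.Icc (0 : ℝ) 1,
        w.2 * ⟪S, w.1⟫ + w.2 ^ 2 / η ≤ r * ⟪S, z⟫ + r ^ 2 / η := by
    intro S
    have hcont : Continuous fun w : EuclideanSpace ℝ (Fin d) × ℝ =>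
        w.2 * ⟪S, w.1⟫ + w.2 ^ 2 / η := by fun_prop
    obtain ⟨w, hw, hle⟩ := (hc.prod isCompact_Icc).exists_isMinOn
      (hne.prod (Set.nonempty_Icc.2 zero_le_one)) hcont.continuousOn
    exact ⟨w, hw, fun z hz r hr => hle (Set.mk_mem_prod hz hr)⟩
  choose w hw hle using hmin
  let F : (t : ℕ) → ((s : ℕ) → s < t → EuclideanSpace ℝ (Fin d)) → EuclideanSpace ℝ (Fin d) :=
    fun t ih => if t = 0 then x₀ else
      let S := aggregatedGradient f (fun s => if h : s < t then ih s h else 0) t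
      (w S).2 • (w S).1
  let x : ℕ → EuclideanSpace ℝ (Fin d) := fun t => Nat.strongRec (motive := fun _ => EuclideanSpace ℝ (Fin d)) F t
  have hx : ∀ t, x t = F t fun s _ => x s := fun t => by
    simp only [x]
    rw [Nat.strongRec_eq]
  refine ⟨x, fun t => (w (aggregatedGradient f x t)).1, fun t => (w (aggregatedGradient f x t)).2,
    ?_, fun t _ => (hw _).1, fun t _ => (hw _).2, fun t _ => hle _, fun t ht => ?_⟩
  · rw [hx]; simp [F]
  · have e : aggregatedGradient f (fun s => if _ : s < t then x s else 0) t =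
        aggregatedGradient f x t := aggregatedGradient_congr f fun s hs => by simp [hs]
    rw [hx t]
    simp only [F, if_neg (by omega : t ≠ 0), e]

variable {x v : ℕ → EuclideanSpace ℝ (Fin d)} {ρ : ℕ → ℝ}

theorem IsGaugeFrankWolfeRun.mem (h : IsGaugeFrankWolfeRun K f η x₀ x v ρ) (hK : Convex ℝ K)
    (h0 : (0 : EuclideanSpace ℝ (Fin d)) ∈ K) (hx₀ : x₀ ∈ K) (t : ℕ) : x t ∈ K := by
  rcases Nat.eq_zero_or_pos t with rfl | ht
  · rw [h.init]; exact hx₀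
  · rw [h.step t ht]
    exact hK.smul_mem_of_zero_mem h0 (h.direction_mem t ht) (h.scale_mem t ht)

/-- The iterates minimize the aggregated linear loss regularized by the squared gauge. -/
theorem IsGaugeFrankWolfeRun.inner_add_gauge_sq_le (h : IsGaugeFrankWolfeRun K f η x₀ x v ρ)
    (hη : 0 < η) (hK : Convex ℝ K) (hc : IsCompact K)
    (h0 : K ∈ nhds (0 : EuclideanSpace ℝ (Fin d))) {t : ℕ} (ht : 1 ≤ t)
    {z : EuclideanSpace ℝ (Fin d)} (hz : z ∈ K) :
    ⟪aggregatedGradient f x t, x t⟫ + gauge K (x t) ^ 2 / η ≤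
      ⟪aggregatedGradient f x t, z⟫ + gauge K z ^ 2 / η := by
  obtain ⟨p, hp, hzp⟩ := exists_mem_eq_gauge_smul hK hc h0 z
  have h1 := h.isMin t ht p hp (gauge K z) ⟨gauge_nonneg z, gauge_le_one_of_mem hz⟩
  rw [← real_inner_smul_right, ← real_inner_smul_right, ← hzp, ← h.step t ht] at h1
  have h2 : gauge K (x t) ≤ ρ t :=
    gauge_le_of_mem (h.scale_mem t ht).1
      (h.step t ht ▸ Set.smul_mem_smul_set (h.direction_mem t ht))
  have h3 : gauge K (x t) ^ 2 / η ≤ ρ t ^ 2 / η := by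
    have := gauge_nonneg (s := K) (x t)
    gcongr
  linarith

theorem IsGaugeFrankWolfeRun.inner_add_gauge_sq_add_le
    (h : IsGaugeFrankWolfeRun K f η x₀ x v ρ)
    (hη : 0 < η) (hK : Convex ℝ K) (hc : IsCompact K)
    (h0 : K ∈ nhds (0 : EuclideanSpace ℝ (Fin d))) {c : ℝ}
    (hgauge : ∀ x y : EuclideanSpace ℝ (Fin d), gauge K ((1 / 2 : ℝ) • (x + y)) ^ 2 ≤
      (gauge K x ^ 2 + gauge K y ^ 2) / 2 - c * ‖x - y‖ ^ 2)
    {t : ℕ} (ht : 1 ≤ t) (hxt : x t ∈ K) {z : EuclideanSpace ℝ (Fin d)} (hz : z ∈ K) :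
    ⟪aggregatedGradient f x t, x t⟫ + gauge K (x t) ^ 2 / η + 2 * (c / η) * ‖z - x t‖ ^ 2 ≤
      ⟪aggregatedGradient f x t, z⟫ + gauge K z ^ 2 / η := by
  have hm : (1 / 2 : ℝ) • (z + x t) ∈ K := by
    rw [smul_add]
    exact hK hz hxt (by norm_num) (by norm_num) (by norm_num)
  have h1 := h.inner_add_gauge_sq_le hη hK hc h0 ht hm
  have h2 := div_le_div_of_nonneg_right (hgauge z (x t)) hη.le
  have e : ((gauge K z ^ 2 + gauge K (x t) ^ 2) / 2 - c * ‖z - x t‖ ^ 2) / η =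
      (gauge K z ^ 2 / η + gauge K (x t) ^ 2 / η) / 2 - c / η * ‖z - x t‖ ^ 2 := by ring
  rw [real_inner_smul_right, inner_add_right] at h1
  rw [e] at h2
  linarith

theorem IsGaugeFrankWolfeRun.weightSum_mul_le (h : IsGaugeFrankWolfeRun K f η x₀ x v ρ)
    (hη : 0 < η) (hK : Convex ℝ K) (hc : IsCompact K)
    (h0 : K ∈ nhds (0 : EuclideanSpace ℝ (Fin d))) {c L : ℝ}
    (hgauge : ∀ x y : EuclideanSpace ℝ (Fin d), gauge K ((1 / 2 : ℝ) • (x + y)) ^ 2 ≤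
      (gauge K x ^ 2 + gauge K y ^ 2) / 2 - c * ‖x - y‖ ^ 2)
    (hL : 0 ≤ L) (hLc : L ≤ c / η) (hf : ConvexOn ℝ Set.univ f)
    (hd : ∀ x ∈ K, DifferentiableAt ℝ f x) (hs : IsStronglySmoothOn L K f)
    (hx₀ : x₀ ∈ K) (n : ℕ) (u : EuclideanSpace ℝ (Fin d)) :
    weightSum (n + 1) * (f (averagedIterate x (n + 1)) - f u) ≤
      ⟪aggregatedGradient f x (n + 1), x (n + 1)⟫ + gauge K (x (n + 1)) ^ 2 / η -
        ⟪aggregatedGradient f x (n + 1), u⟫ + 2 * L * ‖x 1 - x 0‖ ^ 2 := by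
  have hx := h.mem hK (mem_of_mem_nhds h0) hx₀
  have hstep := weightSum_mul_le_succ hL hK (mem_of_mem_nhds h0) hx hf hd hs
  induction n with
  | zero =>
    have h1 := hstep 0 u
    have hg : 0 ≤ gauge K (x 1) ^ 2 / η := by positivity
    have ew : weightSum 0 = 0 := by simp [weightSum]
    have ea : aggregatedGradient f x 0 = 0 := by simp [aggregatedGradient]
    rw [aggregatedGradient_succ, ea, zero_add]
    rw [ew, zero_mul, inner_sub_right] at h1
    simp only [zero_add, Nat.cast_one, one_smul] at h1 hg ⊢
    linarith
  | succ n ih =>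
    have h1 := hstep (n + 1) u
    have h2 := h.inner_add_gauge_sq_add_le hη hK hc h0 hgauge (by omega : 1 ≤ n + 1)
      (hx (n + 1)) (hx (n + 1 + 1))
    have h3 : L * ‖x (n + 1 + 1) - x (n + 1)‖ ^ 2 ≤ c / η * ‖x (n + 1 + 1) - x (n + 1)‖ ^ 2 := by
      gcongr
    rw [aggregatedGradient_succ f x (n + 1), inner_add_left, inner_add_left]
    rw [inner_sub_right] at h1
    linarith

end Run

theorem mainTheorem4 (d : ℕ) (K C : Set (EuclideanSpace ℝ (Fin d)))
    (hK : IsConvexBody K) (hK0 : (0 : EuclideanSpace ℝ (Fin d)) ∈ interior K)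
    (hC : IsConvexBody C) (hC0 : (0 : EuclideanSpace ℝ (Fin d)) ∈ interior C)
    (lam : ℝ) (hlam : 0 < lam) (hKC : IsStronglyConvexSet lam C K) :
    (∀ L : ℝ, 0 ≤ L → ∃ η₀ : ℝ, 0 < η₀ ∧ ∀ η : ℝ, 0 < η → η ≤ η₀ → ∃ M : ℝ,
      ∀ f : EuclideanSpace ℝ (Fin d) → ℝ, ConvexOn ℝ Set.univ f →
        (∀ x ∈ K, DifferentiableAt ℝ f x) → IsStronglySmoothOn L K f →
        ∀ x₀ ∈ K,
          (∃ (x v : ℕ → EuclideanSpace ℝ (Fin d)) (ρ : ℕ → ℝ),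
            IsGaugeFrankWolfeRun K f η x₀ x v ρ) ∧
          ∀ (x v : ℕ → EuclideanSpace ℝ (Fin d)) (ρ : ℕ → ℝ),
            IsGaugeFrankWolfeRun K f η x₀ x v ρ →
            ∀ T : ℕ, 1 ≤ T →
              averagedIterate x T ∈ K ∧
              ∀ u ∈ K, f (averagedIterate x T) - f u ≤ M / (T : ℝ) ^ 2) ∧
    (∀ f : EuclideanSpace ℝ (Fin d) → ℝ, ConvexOn ℝ Set.univ f → ContDiff ℝ 2 f →
      ∃ L : ℝ, 0 ≤ L ∧ IsStronglySmoothOn L K f) := by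
  refine ⟨fun L hL => ?_, fun f _ hf => hf.exists_isStronglySmoothOn hK.convex hK.isCompact⟩
  have hKn : K ∈ nhds 0 := mem_interior_iff_mem_nhds.1 hK0
  obtain ⟨δ, hδ, hball⟩ := hKC.exists_ball hlam hC.isCompact.isBounded
    (mem_interior_iff_mem_nhds.1 hC0)
  obtain ⟨c, hc, hgauge⟩ := exists_gauge_sq_midpoint_le hK.convex hK.isCompact hKn hδ hball
  obtain ⟨R, hR, hKR⟩ := hK.isCompact.isBounded.exists_pos_norm_le
  refine ⟨c / (L + 1), by positivity, fun η hη hηle => ⟨2 * (1 / η + 2 * L * (2 * R) ^ 2), ?_⟩⟩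
  have hLc : L ≤ c / η := by
    rw [le_div_iff₀ (by positivity)] at hηle ⊢
    linarith
  intro f hf hd hs x₀ hx₀
  refine ⟨exists_isGaugeFrankWolfeRun hK.isCompact ⟨x₀, hx₀⟩ f η x₀, fun x v ρ h T hT => ?_⟩
  have hx := h.mem hK.convex (mem_of_mem_nhds hKn) hx₀
  refine ⟨averagedIterate_mem hK.convex (mem_of_mem_nhds hKn) hx T, fun u hu => ?_⟩
  obtain ⟨n, rfl⟩ := Nat.exists_eq_add_of_le' hT
  have h1 := h.weightSum_mul_le hη hK.convex hK.isCompact hKn hgauge hL hLc hf hd hs hx₀ n u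
  have h2 := h.inner_add_gauge_sq_le hη hK.convex hK.isCompact hKn hT hu
  have h3 : gauge K u ^ 2 / η ≤ 1 / η := by
    gcongr
    exact pow_le_one₀ (gauge_nonneg u) (gauge_le_one_of_mem hu)
  have h4 : 2 * L * ‖x 1 - x 0‖ ^ 2 ≤ 2 * L * (2 * R) ^ 2 := by
    gcongr
    exact (norm_sub_le _ _).trans (by linarith [hKR _ (hx 1), hKR _ (hx 0)])
  rw [le_div_iff₀ (by positivity)]
  have hM : 0 ≤ 1 / η + 2 * L * (2 * R) ^ 2 := by positivity
  have h5 : weightSum (n + 1) * (f (averagedIterate x (n + 1)) - f u) ≤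
      1 / η + 2 * L * (2 * R) ^ 2 := by linarith
  rcases le_total (f (averagedIterate x (n + 1)) - f u) 0 with hneg | hpos
  · exact (mul_nonpos_of_nonpos_of_nonneg hneg (by positivity)).trans (by positivity)
  · have h6 : ((n + 1 : ℕ) : ℝ) ^ 2 ≤ 2 * weightSum (n + 1) := by
      rw [weightSum_eq]
      nlinarith [(Nat.cast_nonneg (n + 1) : (0 : ℝ) ≤ ((n + 1 : ℕ) : ℝ))]
    have h7 := mul_le_mul_of_nonneg_left h6 hpos
    linarith
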